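/- Let $\mathbf{FHilb}$ be the dagger symmetric monoidal category of finite-dimensional complex Hilbert spaces and linear maps ($\otimes$ the tensor product, $\dagger$ the adjoint). Let $\mathbf{CPM}(\mathbf{FHilb})$ have the same objects; a morphism $A\to B$ is a completely positive map $A\otimes A^*\to B\otimes B^*$, i.e. one obtained from some linear $g:A\to B\otimes C$ by tracing $C$ out of $g\otimes g_*$, where $g_*=(g^\dagger)^*$. It is a dagger monoidal category with the tensor product and the adjoint inherited from $\mathbf{FHilb}$. Let $F:\mathbf{FHilb}\to\mathbf{CPM}(\mathbf{FHilb})$ be the strict monoidal functor that is the identity on objects (the object $F(A)$ standing for $A\otimes A^*$) and sends $f$ to $f\otimes f_*$. A projector-valued spectrum $(\Pi,\mu)$ on objects $S,p$ of $\mathbf{FHilb}$ consists of a special commutative $\dagger$-Frobenius algebra $\mu:p\otimes p\to p$ with unit $\eta:\mathbb C\to p$ and comultiplication $\delta=\mu^\dagger$, and a linear map $\Pi:S\otimes p\to S$ such that (suppressing associators and unitors) - $\Pi\circ(\Pi\otimes 1_p)=\Pi\circ(1_S\otimes\mu)$ ($p$-idempotent), - $\Pi^\dagger=(\Pi\otimes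 1_p)\circ(1_S\otimes(\delta\circ\eta))$ ($p$-self-adjoint), - $\Pi\circ(1_S\otimes\eta)=1_S$ ($p$-complete). Let $D:F(p)\to F(p)$ be the decoherence morphism in $\mathbf{CPM}(\mathbf{FHilb})$, i.e. $F(\delta)$ followed by discarding (tracing out) one of the two copies of $p$. The quantum measurement of $(\Pi,\mu)$ is the pair $$Q(\Pi)=(1_{F(S)}\otimes D)\circ F(\Pi^\dagger):F(S)\to F(S)\otimes F(p),\qquad Q(\mu)=(D\otimes D)\circ F(\mu^\dagger)\circ D:F(p)\to F(p)\otimes F(p).$$ A weak update structure $(\mathrm{put},\mathrm{get},\mathrm{mix},\mathrm{copy})$ on a system $S$ and a property $p$ in a monoidal category consists of morphisms $\mathrm{put}:S\otimes p\to S$, $\mathrm{get}:S\to S\otimes p$, $\mathrm{mix}:p\otimes p\to p$, $\mathrm{copy}:p\to p\otimes p$ such that (suppressing associators) - $\mathrm{put}\circ(\mathrm{put}\otimes 1_p)=\mathrm{put}\circ(1_S\otimes\mathrm{mix})$ (PutPut), - $(\mathrm{get}\otimes 1_p)\circ\mathrm{get}=(1_S\otimes\mathrm{copy})\circ\mathrm{get}$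 (GetGet), - $\mathrm{get}\circ\mathrm{put}=(\mathrm{put}\otimes 1_p)\circ(1_S\otimes\mathrm{copy})$ (PutGet), - $\mathrm{put}\circ(\mathrm{put}\otimes 1_p)\circ(1_S\otimes\mathrm{copy})=\mathrm{put}$ (repeat-update). Corollary. For every projector-valued spectrum $(\Pi,\mu)$ in $\mathbf{FHilb}$ with quantum measurement $(Q(\Pi),Q(\mu))$, the tuple $(Q(\Pi)^\dagger,\,Q(\Pi),\,Q(\mu)^\dagger,\,Q(\mu))$ is a weak update structure in $\mathbf{CPM}(\mathbf{FHilb})$ on the system $F(S)$ and the property $F(p)$. -/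

import Mathlib

open CategoryTheory MonoidalCategory

/-- A dagger on a category: an identity-on-objects, involutive, contravariant functor. -/
class DaggerCategory (C : Type*) [Category C] where
  dagger : ∀ {X Y : C}, (X ⟶ Y) → (Y ⟶ X)
  dagger_id : ∀ X : C, dagger (𝟙 X) = 𝟙 X
  dagger_comp : ∀ {X Y Z : C} (f : X ⟶ Y) (g : Y ⟶ Z), dagger (f ≫ g) = dagger g ≫ dagger f
  dagger_dagger : ∀ {X Y : C} (f : X ⟶ Y), dagger (dagger f) = f

/-- The dagger `f†` of a morphism. -/
postfix:max "†" => DaggerCategory.dagger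

/-- The axioms of a weak update structure `(put, get, mix, copy)` on a system `S` and a
property `p` in a monoidal category. -/
structure IsWeakUpdateStructure {C : Type*} [Category C] [MonoidalCategory C] {S p : C}
    (put : S ⊗ p ⟶ S) (get : S ⟶ S ⊗ p) (mix : p ⊗ p ⟶ p) (copy : p ⟶ p ⊗ p) : Prop where
  put_put : put ▷ p ≫ put = (α_ S p p).hom ≫ S ◁ mix ≫ put
  get_get : get ≫ get ▷ p = get ≫ S ◁ copy ≫ (α_ S p p).inv
  put_get : put ≫ get = S ◁ copy ≫ (α_ S p p).inv ≫ put ▷ p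
  /-- Updating twice with copies of a property is the same as updating once. -/
  repeat_update : S ◁ copy ≫ (α_ S p p).inv ≫ put ▷ p ≫ put = put

/-! ### The dagger symmetric monoidal category of finite-dimensional Hilbert spaces -/

/-- A finite-dimensional complex Hilbert space. -/
structure FHilb : Type 1 where
  carrier : Type
  [instNormed : NormedAddCommGroup carrier]
  [instInnerProduct : InnerProductSpace ℂ carrier]
  [instFinite : FiniteDimensional ℂ carrier]

namespace FHilb

attribute [instance] FHilb.instNormed FHilb.instInnerProduct FHilb.instFinite

instance : CoeSort FHilb Type := ⟨FHilb.carrier⟩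

/-- Morphisms of `FHilb` are the linear maps. -/
@[ext]
structure Hom (A B : FHilb) where
  lin : A →ₗ[ℂ] B

instance : Category FHilb where
  Hom := Hom
  id _ := ⟨LinearMap.id⟩
  comp f g := ⟨g.lin ∘ₗ f.lin⟩

@[ext] theorem hom_ext {A B : FHilb} {f g : A ⟶ B} (h : f.lin = g.lin) : f = g := Hom.ext h
@[simp] theorem id_lin (A : FHilb) : Hom.lin (𝟙 A) = LinearMap.id := rfl
@[simp] theorem comp_lin {A B C : FHilb} (f : A ⟶ B) (g : B ⟶ C) :
    (f ≫ g).lin = g.lin ∘ₗ f.lin := rfl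

noncomputable instance : DaggerCategory FHilb where
  dagger f := ⟨LinearMap.adjoint f.lin⟩
  dagger_id _ := by ext1; exact LinearMap.adjoint_id
  dagger_comp _ _ := by ext1; exact LinearMap.adjoint_comp _ _
  dagger_dagger _ := by ext1; exact LinearMap.adjoint_adjoint _

@[simp] theorem dagger_lin {A B : FHilb} (f : A ⟶ B) : f†.lin = LinearMap.adjoint f.lin := rfl

/-- A linear isomorphism as an isomorphism of `FHilb`. -/
def ofEquiv {A B : FHilb} (e : A ≃ₗ[ℂ] B) : A ≅ B where
  hom := ⟨e.toLinearMap⟩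
  inv := ⟨e.symm.toLinearMap⟩
  hom_inv_id := by ext1; simp
  inv_hom_id := by ext1; simp

@[simp] theorem ofEquiv_hom_lin {A B : FHilb} (e : A ≃ₗ[ℂ] B) :
    (ofEquiv e).hom.lin = e.toLinearMap := rfl
@[simp] theorem ofEquiv_inv_lin {A B : FHilb} (e : A ≃ₗ[ℂ] B) :
    (ofEquiv e).inv.lin = e.symm.toLinearMap := rfl

noncomputable instance : MonoidalCategoryStruct FHilb where
  tensorObj A B := ⟨TensorProduct ℂ A B⟩
  whiskerLeft _ _ _ f := ⟨TensorProduct.map LinearMap.id f.lin⟩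
  whiskerRight f _ := ⟨TensorProduct.map f.lin LinearMap.id⟩
  tensorHom f g := ⟨TensorProduct.map f.lin g.lin⟩
  tensorUnit := ⟨ℂ⟩
  associator A B C := ofEquiv (TensorProduct.assoc ℂ A B C)
  leftUnitor A := ofEquiv (TensorProduct.lid ℂ A)
  rightUnitor A := ofEquiv (TensorProduct.rid ℂ A)

/-- The pure tensor `a ⊗ b`. -/
noncomputable def tmul {A B : FHilb} (a : A) (b : B) : (A ⊗ B : FHilb) :=
  TensorProduct.tmul ℂ (M := A) (N := B) a b

infixr:70 " ⊗ᵥ " => tmul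

section tmul

variable {A B C : FHilb} (a a' : A) (b b' : B) (c : C)

theorem add_tmul : (a + a') ⊗ᵥ b = a ⊗ᵥ b + a' ⊗ᵥ b := TensorProduct.add_tmul a a' b
theorem tmul_add : a ⊗ᵥ (b + b') = a ⊗ᵥ b + a ⊗ᵥ b' := TensorProduct.tmul_add a b b'
@[simp] theorem zero_tmul : (0 : A) ⊗ᵥ b = 0 := TensorProduct.zero_tmul A b
@[simp] theorem tmul_zero : a ⊗ᵥ (0 : B) = 0 := TensorProduct.tmul_zero B a
@[simp] theorem smul_tmul (z : ℂ) : (z • a) ⊗ᵥ b = z • (a ⊗ᵥ b) := rfl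
@[simp] theorem tmul_smul (z : ℂ) : a ⊗ᵥ (z • b) = z • (a ⊗ᵥ b) := TensorProduct.tmul_smul z a b
@[simp] theorem inner_tmul : inner ℂ (a ⊗ᵥ b) (a' ⊗ᵥ b') = inner ℂ a a' * inner ℂ b b' :=
  TensorProduct.inner_tmul (𝕜 := ℂ) (E := A) (F := B) a a' b b'

theorem sum_tmul {ι : Type*} (s : Finset ι) (f : ι → A) :
    (∑ i ∈ s, f i) ⊗ᵥ b = ∑ i ∈ s, f i ⊗ᵥ b := TensorProduct.sum_tmul s f b
theorem tmul_sum {ι : Type*} (s : Finset ι) (f : ι → B) :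
    a ⊗ᵥ (∑ i ∈ s, f i) = ∑ i ∈ s, a ⊗ᵥ f i := TensorProduct.tmul_sum a s f

@[elab_as_elim]
theorem tensor_induction {P : (A ⊗ B : FHilb) → Prop} (x : (A ⊗ B : FHilb)) (zero : P 0)
    (tmul : ∀ a b, P (a ⊗ᵥ b)) (add : ∀ x y, P x → P y → P (x + y)) : P x :=
  TensorProduct.induction_on (R := ℂ) (M := A) (N := B) x zero tmul add

@[simp] theorem tensorHom_tmul {D : FHilb} (f : A ⟶ C) (g : B ⟶ D) :
    (f ⊗ₘ g).lin (a ⊗ᵥ b) = f.lin a ⊗ᵥ g.lin b := rfl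
@[simp] theorem whiskerLeft_tmul (g : B ⟶ C) : (A ◁ g).lin (a ⊗ᵥ b) = a ⊗ᵥ g.lin b := rfl
@[simp] theorem whiskerRight_tmul (f : A ⟶ C) : (f ▷ B).lin (a ⊗ᵥ b) = f.lin a ⊗ᵥ b := rfl
@[simp] theorem associator_hom_tmul :
    (α_ A B C).hom.lin ((a ⊗ᵥ b) ⊗ᵥ c) = a ⊗ᵥ (b ⊗ᵥ c) := rfl
@[simp] theorem associator_inv_tmul :
    (α_ A B C).inv.lin (a ⊗ᵥ (b ⊗ᵥ c)) = (a ⊗ᵥ b) ⊗ᵥ c := rfl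
@[simp] theorem leftUnitor_hom_tmul (z : ℂ) :
    (λ_ A).hom.lin (tmul (A := 𝟙_ FHilb) z a) = z • a := rfl
@[simp] theorem leftUnitor_inv_apply : (λ_ A).inv.lin a = tmul (A := 𝟙_ FHilb) (1 : ℂ) a := rfl
@[simp] theorem rightUnitor_hom_tmul (z : ℂ) :
    (ρ_ A).hom.lin (tmul (B := 𝟙_ FHilb) a z) = z • a := rfl
@[simp] theorem rightUnitor_inv_apply : (ρ_ A).inv.lin a = tmul (B := 𝟙_ FHilb) a (1 : ℂ) := rfl

/-- Morphisms out of a tensor product agree when they agree on pure tensors. -/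
theorem tensor_ext {f g : A ⊗ B ⟶ C} (h : ∀ a b, f.lin (a ⊗ᵥ b) = g.lin (a ⊗ᵥ b)) : f = g :=
  hom_ext (TensorProduct.ext' h)

theorem tensor_ext₃ {D : FHilb} {f g : (A ⊗ B) ⊗ C ⟶ D}
    (h : ∀ a b c, f.lin ((a ⊗ᵥ b) ⊗ᵥ c) = g.lin ((a ⊗ᵥ b) ⊗ᵥ c)) : f = g :=
  hom_ext (TensorProduct.ext_threefold h)

theorem tensor_ext₄ {D E : FHilb} {f g : ((A ⊗ B) ⊗ C) ⊗ D ⟶ E}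
    (h : ∀ a b c d, f.lin (((a ⊗ᵥ b) ⊗ᵥ c) ⊗ᵥ d) = g.lin (((a ⊗ᵥ b) ⊗ᵥ c) ⊗ᵥ d)) : f = g :=
  hom_ext (TensorProduct.ext_fourfold h)

theorem span_tmul {S : Set A} {T : Set B} (hS : Submodule.span ℂ S = ⊤)
    (hT : Submodule.span ℂ T = ⊤) : Submodule.span ℂ (Set.image2 tmul S T) = ⊤ := by
  have h := Submodule.map₂_span_span ℂ (TensorProduct.mk ℂ A B) S T
  rw [hS, hT, TensorProduct.map₂_mk_top_top_eq_top] at h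
  exact h.symm

/-- Morphisms that agree on a spanning set are equal. -/
theorem span_ext {S : Set A} (hS : Submodule.span ℂ S = ⊤) {f g : A ⟶ B}
    (h : ∀ a ∈ S, f.lin a = g.lin a) : f = g :=
  hom_ext (LinearMap.ext_on hS h)

/-- Adjointness may be checked on spanning sets. -/
theorem eq_dagger {S : Set A} {T : Set B} (hS : Submodule.span ℂ S = ⊤)
    (hT : Submodule.span ℂ T = ⊤) {f : A ⟶ B} {g : B ⟶ A}
    (h : ∀ a ∈ S, ∀ b ∈ T, inner ℂ (f.lin a) b = inner ℂ a (g.lin b)) : f = g† := by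
  refine hom_ext ((LinearMap.eq_adjoint_iff _ _).2 fun x y => ?_)
  have hx : x ∈ Submodule.span ℂ S := hS ▸ Submodule.mem_top
  have hy : y ∈ Submodule.span ℂ T := hT ▸ Submodule.mem_top
  induction hx using Submodule.span_induction with
  | zero => simp
  | add x x' _ _ hx hx' => simp [inner_add_left, hx, hx']
  | smul z x _ hx => simp [inner_smul_left, hx]
  | mem a ha =>
    induction hy using Submodule.span_induction with
    | zero => simp
    | add y y' _ _ hy hy' => simp [inner_add_right, hy, hy']
    | smul z y _ hy => simp [inner_smul_right, hy]
    | mem b hb => exact h a ha b hb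

end tmul

noncomputable instance : MonoidalCategory FHilb :=
  MonoidalCategory.ofTensorHom
    (id_tensorHom_id := fun _ _ => tensor_ext fun _ _ => rfl)
    (id_tensorHom := fun _ _ _ _ => rfl)
    (tensorHom_id := fun _ _ => rfl)
    (tensorHom_comp_tensorHom := fun _ _ _ _ => tensor_ext fun _ _ => rfl)
    (associator_naturality := fun _ _ _ => tensor_ext₃ fun _ _ _ => rfl)
    (leftUnitor_naturality := fun f => tensor_ext fun (a : ℂ) b => (f.lin.map_smul a b).symm)
    (rightUnitor_naturality := fun f => tensor_ext fun a (b : ℂ) => (f.lin.map_smul b a).symm)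
    (pentagon := fun _ _ _ _ => tensor_ext₄ fun _ _ _ _ => rfl)
    (triangle := fun _ _ => tensor_ext₃ fun a (c : ℂ) b => (TensorProduct.smul_tmul c a b).symm)

noncomputable instance : SymmetricCategory FHilb where
  braiding A B := ofEquiv (TensorProduct.comm ℂ A B)
  braiding_naturality_right _ _ _ _ := tensor_ext fun _ _ => rfl
  braiding_naturality_left _ _ := tensor_ext fun _ _ => rfl
  hexagon_forward _ _ _ := tensor_ext₃ fun _ _ _ => rfl
  hexagon_reverse A B C := by
    rw [← cancel_epi (α_ A B C).hom]
    exact tensor_ext₃ fun _ _ _ => rfl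
  symmetry _ _ := tensor_ext fun _ _ => rfl

@[simp] theorem braiding_hom_tmul {A B : FHilb} (a : A) (b : B) :
    (β_ A B).hom.lin (a ⊗ᵥ b) = b ⊗ᵥ a := rfl

/-- The dual Hilbert space `A*`: the functionals on `A`, with the inner product for which the
(conjugate-linear) Riesz map `a ↦ ⟪a, -⟫` is unitary. -/
noncomputable def dual (A : FHilb) : FHilb where
  carrier := StrongDual ℂ A
  instInnerProduct :=
    { inner := fun φ ψ =>
        inner ℂ ((InnerProductSpace.toDual ℂ A).symm ψ) ((InnerProductSpace.toDual ℂ A).symm φ)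
      norm_sq_eq_re_inner := fun φ => by
        rw [inner_self_eq_norm_sq, LinearIsometryEquiv.norm_map]
      conj_inner_symm := fun φ ψ => inner_conj_symm _ _
      add_left := fun φ ψ χ => by
        rw [map_add, inner_add_right]
      smul_left := fun φ ψ c => by
        rw [LinearIsometryEquiv.map_smulₛₗ, inner_smul_right] }
  instFinite := (inferInstance : FiniteDimensional ℂ (StrongDual ℂ A))

/-- The functional `⟪a, -⟫`. -/
noncomputable def bra {A : FHilb} (a : A) : dual A := InnerProductSpace.toDual ℂ A a

theorem bra_surjective {A : FHilb} (φ : dual A) : ∃ a, bra a = φ :=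
  (InnerProductSpace.toDual ℂ A).surjective φ

theorem bra_add {A : FHilb} (a b : A) : bra (a + b) = bra a + bra b :=
  map_add (InnerProductSpace.toDual ℂ A) a b

theorem bra_sum {A : FHilb} {ι : Type*} (s : Finset ι) (f : ι → A) :
    bra (∑ i ∈ s, f i) = ∑ i ∈ s, bra (f i) :=
  map_sum (InnerProductSpace.toDual ℂ A) f s

@[simp] theorem bra_zero {A : FHilb} : bra (0 : A) = 0 :=
  map_zero (InnerProductSpace.toDual ℂ A)

@[simp] theorem bra_smul {A : FHilb} (z : ℂ) (a : A) : bra (z • a) = star z • bra a :=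
  LinearIsometryEquiv.map_smulₛₗ (InnerProductSpace.toDual ℂ A) z a

@[simp] theorem inner_bra {A : FHilb} (a b : A) : inner ℂ (bra a) (bra b) = inner ℂ b a := by
  change inner ℂ ((InnerProductSpace.toDual ℂ A).symm (InnerProductSpace.toDual ℂ A b))
    ((InnerProductSpace.toDual ℂ A).symm (InnerProductSpace.toDual ℂ A a)) = _
  simp

/-- The map `f_* = (f†)^* : A* ⟶ B*`, i.e. precomposition with `f†`. -/
noncomputable def conj {A B : FHilb} (f : A ⟶ B) : dual A ⟶ dual B :=
  ⟨{ toFun := fun φ : A →L[ℂ] ℂ => φ ∘L LinearMap.toContinuousLinearMap (f†.lin)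
     map_add' := fun _ _ => rfl
     map_smul' := fun _ _ => rfl }⟩

@[simp] theorem conj_bra {A B : FHilb} (f : A ⟶ B) (a : A) :
    (conj f).lin (bra a) = bra (f.lin a) := by
  refine ContinuousLinearMap.ext fun b => ?_
  exact LinearMap.adjoint_inner_right f.lin a b

/-- Evaluation `A ⊗ A* ⟶ ℂ`, `a ⊗ φ ↦ φ a`. -/
noncomputable def eval (A : FHilb) : A ⊗ dual A ⟶ 𝟙_ FHilb :=
  ⟨TensorProduct.lift (LinearMap.flip
    { toFun := fun φ : A →L[ℂ] ℂ => φ.toLinearMap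
      map_add' := fun _ _ => rfl
      map_smul' := fun _ _ => rfl })⟩

@[simp] theorem eval_bra {A : FHilb} (a b : A) :
    (eval A).lin (a ⊗ᵥ bra b) = (inner ℂ b a : ℂ) := rfl

/-- The canonical isomorphism `A* ⊗ B* ≅ (A ⊗ B)*`, with `(φ ⊗ ψ) (a ⊗ b) = φ a * ψ b`. -/
noncomputable def dualTensor (A B : FHilb) : dual A ⊗ dual B ≅ dual (A ⊗ B) :=
  ofEquiv <|
    (TensorProduct.congr
      (LinearMap.toContinuousLinearMap (𝕜 := ℂ) (E := A) (F' := ℂ)).symm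
      (LinearMap.toContinuousLinearMap (𝕜 := ℂ) (E := B) (F' := ℂ)).symm).trans
    ((TensorProduct.dualDistribEquiv ℂ A B).trans
      (LinearMap.toContinuousLinearMap (𝕜 := ℂ) (E := TensorProduct ℂ A B) (F' := ℂ)))

@[simp] theorem dualTensor_hom_bra {A B : FHilb} (a : A) (b : B) :
    (dualTensor A B).hom.lin (bra a ⊗ᵥ bra b) = bra (a ⊗ᵥ b) := by
  refine ContinuousLinearMap.ext fun (x : (A ⊗ B : FHilb)) => ?_
  induction x using tensor_induction with
  | zero => exact (map_zero _).trans (map_zero _).symm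
  | add x y hx hy => exact (map_add _ _ _).trans ((congrArg₂ _ hx hy).trans (map_add _ _ _).symm)
  | tmul x y => exact (inner_tmul a x b y).symm

@[simp] theorem dualTensor_inv_bra {A B : FHilb} (a : A) (b : B) :
    (dualTensor A B).inv.lin (bra (a ⊗ᵥ b)) = bra a ⊗ᵥ bra b := by
  rw [← dualTensor_hom_bra]
  exact congrArg (fun f => f.lin (bra a ⊗ᵥ bra b)) (dualTensor A B).hom_inv_id

/-! ### Doubling -/

/-- The doubled object `A ⊗ A*`. -/
noncomputable abbrev dbl (A : FHilb) : FHilb := A ⊗ dual A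

/-- The doubled morphism `f ⊗ f_*`. -/
noncomputable def double {A B : FHilb} (f : A ⟶ B) : dbl A ⟶ dbl B := f ⊗ₘ conj f

@[simp] theorem double_tmul {A B : FHilb} (f : A ⟶ B) (a b : A) :
    (double f).lin (a ⊗ᵥ bra b) = f.lin a ⊗ᵥ bra (f.lin b) := by
  simp [double]

theorem dbl_ext {A B : FHilb} {f g : dbl A ⟶ B}
    (h : ∀ a b : A, f.lin (a ⊗ᵥ bra b) = g.lin (a ⊗ᵥ bra b)) : f = g :=
  tensor_ext fun a φ => by
    obtain ⟨b, rfl⟩ := bra_surjective φ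
    exact h a b

theorem span_bra {A : FHilb} {S : Set A} (hS : Submodule.span ℂ S = ⊤) :
    Submodule.span ℂ (bra '' S) = ⊤ := by
  have h := Submodule.map_span (InnerProductSpace.toDual ℂ A).toLinearEquiv.toLinearMap S
  rw [hS, Submodule.map_top, LinearMap.range_eq_top.2
    (InnerProductSpace.toDual ℂ A).surjective] at h
  exact h.symm

theorem span_dbl {A : FHilb} {S : Set A} (hS : Submodule.span ℂ S = ⊤) :
    Submodule.span ℂ (Set.image2 (fun a b => a ⊗ᵥ bra b) S S) = ⊤ := by
  rw [← span_tmul hS (span_bra hS), Set.image2_image_right]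

/-- The reordering `(A ⊗ A*) ⊗ (B ⊗ B*) ≅ (A ⊗ B) ⊗ (A ⊗ B)*`. -/
noncomputable def shuffle (A B : FHilb) : dbl A ⊗ dbl B ≅ dbl (A ⊗ B) :=
  ofEquiv (TensorProduct.tensorTensorTensorComm ℂ A (dual A) B (dual B)) ≪≫
    whiskerLeftIso (A ⊗ B : FHilb) (dualTensor A B)

@[simp] theorem shuffle_hom_bra {A B : FHilb} (a a' : A) (b b' : B) :
    (shuffle A B).hom.lin ((a ⊗ᵥ bra a') ⊗ᵥ (b ⊗ᵥ bra b')) = (a ⊗ᵥ b) ⊗ᵥ bra (a' ⊗ᵥ b') := by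
  rw [← dualTensor_hom_bra]
  rfl

@[simp] theorem shuffle_inv_bra {A B : FHilb} (a a' : A) (b b' : B) :
    (shuffle A B).inv.lin ((a ⊗ᵥ b) ⊗ᵥ bra (a' ⊗ᵥ b')) = (a ⊗ᵥ bra a') ⊗ᵥ (b ⊗ᵥ bra b') := by
  rw [← shuffle_hom_bra]
  exact congrArg (fun f => f.lin ((a ⊗ᵥ bra a') ⊗ᵥ (b ⊗ᵥ bra b'))) (shuffle A B).hom_inv_id

/-- The partial trace over `C`. -/
noncomputable def partialTrace (B C : FHilb) : dbl (B ⊗ C) ⟶ dbl B :=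
  (shuffle B C).inv ≫ dbl B ◁ eval C ≫ (ρ_ (dbl B)).hom

@[simp] theorem partialTrace_bra {B C : FHilb} (b b' : B) (c c' : C) :
    (partialTrace B C).lin ((b ⊗ᵥ c) ⊗ᵥ bra (b' ⊗ᵥ c')) =
      (inner ℂ c' c : ℂ) • (b ⊗ᵥ bra b') := by
  simp [partialTrace]

@[simp] theorem double_id (A : FHilb) : double (𝟙 A) = 𝟙 (dbl A) :=
  dbl_ext fun a b => by simp

@[simp] theorem double_comp {A B C : FHilb} (f : A ⟶ B) (g : B ⟶ C) :
    double (f ≫ g) = double f ≫ double g :=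
  dbl_ext fun a b => by simp

theorem shuffle_ext {A B C : FHilb} {f g : dbl A ⊗ dbl B ⟶ C}
    (h : ∀ a a' b b', f.lin ((a ⊗ᵥ bra a') ⊗ᵥ (b ⊗ᵥ bra b')) =
      g.lin ((a ⊗ᵥ bra a') ⊗ᵥ (b ⊗ᵥ bra b'))) : f = g := by
  refine span_ext (span_tmul (span_dbl Submodule.span_univ) (span_dbl Submodule.span_univ)) ?_
  rintro _ ⟨_, ⟨a, -, a', -, rfl⟩, _, ⟨b, -, b', -, rfl⟩, rfl⟩
  exact h a a' b b'

theorem shuffle_ext₃ {A B C D : FHilb} {f g : (dbl A ⊗ dbl B) ⊗ dbl C ⟶ D}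
    (h : ∀ a a' b b' c c', f.lin (((a ⊗ᵥ bra a') ⊗ᵥ (b ⊗ᵥ bra b')) ⊗ᵥ (c ⊗ᵥ bra c')) =
      g.lin (((a ⊗ᵥ bra a') ⊗ᵥ (b ⊗ᵥ bra b')) ⊗ᵥ (c ⊗ᵥ bra c'))) : f = g := by
  refine span_ext (span_tmul (span_tmul (span_dbl Submodule.span_univ)
    (span_dbl Submodule.span_univ)) (span_dbl Submodule.span_univ)) ?_
  rintro _ ⟨_, ⟨_, ⟨a, -, a', -, rfl⟩, _, ⟨b, -, b', -, rfl⟩, rfl⟩, _, ⟨c, -, c', -, rfl⟩, rfl⟩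
  exact h a a' b b' c c'

theorem double_tensorHom {A B C D : FHilb} (f : A ⟶ B) (g : C ⟶ D) :
    (shuffle A C).hom ≫ double (f ⊗ₘ g) = (double f ⊗ₘ double g) ≫ (shuffle B D).hom :=
  shuffle_ext fun a a' b b' => by simp

theorem shuffle_assoc (A B C : FHilb) :
    (shuffle A B).hom ▷ dbl C ≫ (shuffle (A ⊗ B) C).hom ≫ double (α_ A B C).hom =
      (α_ (dbl A) (dbl B) (dbl C)).hom ≫ dbl A ◁ (shuffle B C).hom ≫ (shuffle A (B ⊗ C)).hom :=
  shuffle_ext₃ fun a a' b b' c c' => by simp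

theorem shuffle_leftUnitor (A : FHilb) :
    (shuffle (𝟙_ FHilb) A).hom ≫ double (λ_ A).hom =
      eval (𝟙_ FHilb) ▷ dbl A ≫ (λ_ (dbl A)).hom :=
  shuffle_ext fun (z w : ℂ) a a' => by simp [smul_smul, mul_comm]

theorem shuffle_rightUnitor (A : FHilb) :
    (shuffle A (𝟙_ FHilb)).hom ≫ double (ρ_ A).hom =
      dbl A ◁ eval (𝟙_ FHilb) ≫ (ρ_ (dbl A)).hom :=
  shuffle_ext fun a a' (z w : ℂ) => by simp [smul_smul, mul_comm]

/-! ### Completely positive morphisms -/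

/-- A morphism `A ⊗ A* ⟶ B ⊗ B*` is completely positive if it arises from some
`g : A ⟶ B ⊗ C` by tracing the ancilla `C` out of `g ⊗ g_*`. -/
def IsCP {A B : FHilb} (f : dbl A ⟶ dbl B) : Prop :=
  ∃ (C : FHilb) (g : A ⟶ B ⊗ C), f = double g ≫ partialTrace B C

theorem isCP_double {A B : FHilb} (f : A ⟶ B) : IsCP (double f) := by
  refine ⟨𝟙_ FHilb, f ≫ (ρ_ B).inv, dbl_ext fun a b => ?_⟩
  simp only [double_comp, comp_lin, LinearMap.comp_apply, double_tmul, rightUnitor_inv_apply,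
    partialTrace_bra]
  change _ = (inner ℂ (1 : ℂ) (1 : ℂ) : ℂ) • _
  simp

theorem partialTrace_double {B C D : FHilb} (h : B ⟶ D) :
    partialTrace B C ≫ double h = double (h ▷ C) ≫ partialTrace D C := by
  refine span_ext (span_dbl (span_tmul Submodule.span_univ Submodule.span_univ)) ?_
  rintro _ ⟨_, ⟨b, -, c, -, rfl⟩, _, ⟨b', -, c', -, rfl⟩, rfl⟩
  simp

theorem partialTrace_partialTrace (E D C : FHilb) :
    partialTrace (E ⊗ D) C ≫ partialTrace E D =
      double (α_ E D C).hom ≫ partialTrace E (D ⊗ C) := by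
  refine span_ext (span_dbl (span_tmul
    (span_tmul Submodule.span_univ Submodule.span_univ) Submodule.span_univ)) ?_
  rintro _ ⟨_, ⟨_, ⟨e, -, d, -, rfl⟩, c, -, rfl⟩, _, ⟨_, ⟨e', -, d', -, rfl⟩, c', -, rfl⟩, rfl⟩
  simp [smul_smul, mul_comm]

theorem IsCP.comp {A B C : FHilb} {f : dbl A ⟶ dbl B} {g : dbl B ⟶ dbl C}
    (hf : IsCP f) (hg : IsCP g) : IsCP (f ≫ g) := by
  obtain ⟨D, k, rfl⟩ := hf
  obtain ⟨E, l, rfl⟩ := hg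
  refine ⟨E ⊗ D, k ≫ l ▷ D ≫ (α_ C E D).hom, ?_⟩
  simp only [double_comp, Category.assoc]
  rw [← partialTrace_partialTrace, ← Category.assoc (double (l ▷ D)), ← partialTrace_double]
  simp

/-- The tensor product of two maps between doubled objects. -/
noncomputable def cpTensor {A B C D : FHilb} (f : dbl A ⟶ dbl B) (g : dbl C ⟶ dbl D) :
    dbl (A ⊗ C) ⟶ dbl (B ⊗ D) :=
  (shuffle A C).inv ≫ (f ⊗ₘ g) ≫ (shuffle B D).hom

theorem cpTensor_double {A B C D : FHilb} (f : A ⟶ B) (g : C ⟶ D) :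
    cpTensor (double f) (double g) = double (f ⊗ₘ g) := by
  rw [cpTensor, ← double_tensorHom, Iso.inv_hom_id_assoc]

theorem cpTensor_id (A B : FHilb) : cpTensor (𝟙 (dbl A)) (𝟙 (dbl B)) = 𝟙 (dbl (A ⊗ B)) := by
  simp [cpTensor]

theorem cpTensor_comp {A B C A' B' C' : FHilb} (f : dbl A ⟶ dbl B) (g : dbl B ⟶ dbl C)
    (f' : dbl A' ⟶ dbl B') (g' : dbl B' ⟶ dbl C') :
    cpTensor (f ≫ g) (f' ≫ g') = cpTensor f f' ≫ cpTensor g g' := by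
  simp [cpTensor]

theorem cpTensor_partialTrace (B C B' C' : FHilb) :
    cpTensor (partialTrace B C) (partialTrace B' C') =
      double (tensorμ B C B' C') ≫ partialTrace (B ⊗ B') (C ⊗ C') := by
  refine span_ext (span_dbl (span_tmul (span_tmul Submodule.span_univ Submodule.span_univ)
    (span_tmul Submodule.span_univ Submodule.span_univ))) ?_
  rintro _ ⟨_, ⟨_, ⟨b, -, c, -, rfl⟩, _, ⟨d, -, e, -, rfl⟩, rfl⟩,
    _, ⟨_, ⟨b', -, c', -, rfl⟩, _, ⟨d', -, e', -, rfl⟩, rfl⟩, rfl⟩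
  simp [cpTensor, tensorμ, smul_smul, mul_comm]

theorem IsCP.tensor {A B C D : FHilb} {f : dbl A ⟶ dbl B} {g : dbl C ⟶ dbl D}
    (hf : IsCP f) (hg : IsCP g) : IsCP (cpTensor f g) := by
  obtain ⟨E, k, rfl⟩ := hf
  obtain ⟨E', l, rfl⟩ := hg
  refine ⟨E ⊗ E', (k ⊗ₘ l) ≫ tensorμ B E D E', ?_⟩
  rw [cpTensor_comp, cpTensor_double, cpTensor_partialTrace, double_comp, Category.assoc]

theorem cpTensor_assoc {A B C A' B' C' : FHilb} (f : dbl A ⟶ dbl A') (g : dbl B ⟶ dbl B')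
    (h : dbl C ⟶ dbl C') :
    cpTensor (cpTensor f g) h ≫ double (α_ A' B' C').hom =
      double (α_ A B C).hom ≫ cpTensor f (cpTensor g h) := by
  have e₁ := shuffle_assoc A B C
  have e₂ := shuffle_assoc A' B' C'
  rw [← cancel_epi (shuffle (A ⊗ B) C).hom, ← cancel_epi ((shuffle A B).hom ▷ dbl C)]
  have k₁ : (cpTensor f g ⊗ₘ h) = (shuffle A B).inv ▷ dbl C ≫ ((f ⊗ₘ g) ⊗ₘ h) ≫
      (shuffle A' B').hom ▷ dbl C' := by
    simp only [cpTensor, ← MonoidalCategory.tensorHom_id, tensorHom_comp_tensorHom,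
      Category.id_comp, Category.comp_id]
  have k₂ : (f ⊗ₘ cpTensor g h) = dbl A ◁ (shuffle B C).inv ≫ (f ⊗ₘ (g ⊗ₘ h)) ≫
      dbl A' ◁ (shuffle B' C').hom := by
    simp only [cpTensor, ← MonoidalCategory.id_tensorHom, tensorHom_comp_tensorHom,
      Category.id_comp, Category.comp_id]
  rw [show cpTensor (cpTensor f g) h = (shuffle (A ⊗ B) C).inv ≫ (cpTensor f g ⊗ₘ h) ≫
      (shuffle (A' ⊗ B') C').hom from rfl, show cpTensor f (cpTensor g h) =
      (shuffle A (B ⊗ C)).inv ≫ (f ⊗ₘ cpTensor g h) ≫ (shuffle A' (B' ⊗ C')).hom from rfl, k₁, k₂]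
  simp only [Category.assoc, Iso.hom_inv_id_assoc, hom_inv_whiskerRight_assoc]
  rw [reassoc_of% e₁, e₂, associator_naturality_assoc]
  simp only [Iso.hom_inv_id_assoc, whiskerLeft_hom_inv_assoc]

theorem cpTensor_leftUnitor {A B : FHilb} (f : dbl A ⟶ dbl B) :
    cpTensor (𝟙 (dbl (𝟙_ FHilb))) f ≫ double (λ_ B).hom = double (λ_ A).hom ≫ f := by
  rw [← cancel_epi (shuffle (𝟙_ FHilb) A).hom, ← Category.assoc _ _ f, shuffle_leftUnitor]
  simp only [cpTensor, Category.assoc, Iso.hom_inv_id_assoc]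
  rw [shuffle_leftUnitor, MonoidalCategory.id_tensorHom, whisker_exchange_assoc,
    leftUnitor_naturality]

theorem cpTensor_rightUnitor {A B : FHilb} (f : dbl A ⟶ dbl B) :
    cpTensor f (𝟙 (dbl (𝟙_ FHilb))) ≫ double (ρ_ B).hom = double (ρ_ A).hom ≫ f := by
  rw [← cancel_epi (shuffle A (𝟙_ FHilb)).hom, ← Category.assoc _ _ f, shuffle_rightUnitor]
  simp only [cpTensor, Category.assoc, Iso.hom_inv_id_assoc]
  rw [shuffle_rightUnitor, MonoidalCategory.tensorHom_id, ← whisker_exchange_assoc,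
    rightUnitor_naturality]

theorem dagger_double {A B : FHilb} (f : A ⟶ B) : (double f)† = double f† := by
  refine (eq_dagger (span_dbl Submodule.span_univ) (span_dbl Submodule.span_univ) ?_).symm
  rintro _ ⟨a, -, a', -, rfl⟩ _ ⟨b, -, b', -, rfl⟩
  simp [LinearMap.adjoint_inner_left, LinearMap.adjoint_inner_right]

theorem isCP_dagger_partialTrace (B C : FHilb) : IsCP (partialTrace B C)† := by
  let e := stdOrthonormalBasis ℂ C
  obtain ⟨g, hg⟩ : ∃ g : B ⟶ (B ⊗ C) ⊗ C, ∀ x : B, g.lin x = ∑ i, (x ⊗ᵥ e i) ⊗ᵥ e i := by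
    let s : (C ⊗ C : FHilb) := ∑ i, e i ⊗ᵥ e i
    let k : B ⟶ B ⊗ (C ⊗ C) := ⟨(TensorProduct.mk ℂ B (C ⊗ C : FHilb)).flip s⟩
    have hk : ∀ b, k.lin b = b ⊗ᵥ s := fun _ => rfl
    refine ⟨k ≫ (α_ B C C).inv, fun x => ?_⟩
    simp only [comp_lin, LinearMap.comp_apply, hk, s, tmul_sum, map_sum, associator_inv_tmul]
  refine ⟨C, g, (eq_dagger (span_dbl Submodule.span_univ)
    (span_dbl (span_tmul Submodule.span_univ Submodule.span_univ)) ?_).symm⟩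
  rintro _ ⟨b, -, b', -, rfl⟩ _ ⟨_, ⟨d, -, c, -, rfl⟩, _, ⟨d', -, c', -, rfl⟩, rfl⟩
  have he : ∀ i j, inner ℂ (e i) (e j) = if i = j then (1 : ℂ) else 0 :=
    orthonormal_iff_ite.1 e.orthonormal
  have hc : ∑ i, inner ℂ (e i) c * inner ℂ c' (e i) = inner ℂ c' c := by
    rw [← e.sum_inner_mul_inner c' c]
    exact Finset.sum_congr rfl fun i _ => mul_comm _ _
  simp only [comp_lin, LinearMap.comp_apply, double_tmul, hg, bra_sum, tmul_sum,
    sum_tmul, map_sum, partialTrace_bra, he, ite_smul, one_smul, zero_smul, Finset.sum_ite_eq,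
    Finset.mem_univ, if_true, sum_inner, inner_tmul, inner_bra, ← hc,
    Finset.sum_mul, inner_smul_right]
  refine Finset.sum_congr rfl fun i _ => ?_
  ring

theorem IsCP.dagger {A B : FHilb} {f : dbl A ⟶ dbl B} (hf : IsCP f) : IsCP f† := by
  obtain ⟨C, k, rfl⟩ := hf
  rw [DaggerCategory.dagger_comp, dagger_double]
  exact (isCP_dagger_partialTrace B C).comp (isCP_double _)

end FHilb

/-! ### The category `CPM(FHilb)` -/

/-- The objects of `CPM(FHilb)`: those of `FHilb`, where `A` stands for `A ⊗ A*`. -/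
structure CPM : Type 1 where
  base : FHilb

namespace CPM

open FHilb

/-- Morphisms `A ⟶ B` of `CPM(FHilb)` are the completely positive maps `A ⊗ A* ⟶ B ⊗ B*`. -/
@[ext]
structure Hom (A B : CPM) where
  map : dbl A.base ⟶ dbl B.base
  cp : IsCP map

noncomputable instance : Category CPM where
  Hom := Hom
  id A := ⟨𝟙 (dbl A.base), by rw [← double_id]; exact isCP_double _⟩
  comp f g := ⟨f.map ≫ g.map, f.cp.comp g.cp⟩

@[ext] theorem hom_ext {A B : CPM} {f g : A ⟶ B} (h : f.map = g.map) : f = g := Hom.ext h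
@[simp] theorem id_map (A : CPM) : Hom.map (𝟙 A) = 𝟙 (dbl A.base) := rfl
@[simp] theorem comp_map {A B C : CPM} (f : A ⟶ B) (g : B ⟶ C) :
    (f ≫ g).map = f.map ≫ g.map := rfl

noncomputable instance : DaggerCategory CPM where
  dagger f := ⟨f.map†, f.cp.dagger⟩
  dagger_id _ := hom_ext (DaggerCategory.dagger_id _)
  dagger_comp _ _ := hom_ext (DaggerCategory.dagger_comp _ _)
  dagger_dagger _ := hom_ext (DaggerCategory.dagger_dagger _)

@[simp] theorem dagger_map {A B : CPM} (f : A ⟶ B) : f†.map = f.map† := rfl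

/-- The functor `FHilb ⥤ CPM(FHilb)`, `f ↦ f ⊗ f_*`. -/
noncomputable def F : FHilb ⥤ CPM where
  obj A := ⟨A⟩
  map f := ⟨double f, isCP_double f⟩
  map_id _ := hom_ext (double_id _)
  map_comp _ _ := hom_ext (double_comp _ _)

@[simp] theorem F_map_map {A B : FHilb} (f : A ⟶ B) : (F.map f).map = double f := rfl

noncomputable instance : MonoidalCategoryStruct CPM where
  tensorObj A B := ⟨A.base ⊗ B.base⟩
  tensorHom f g := ⟨cpTensor f.map g.map, f.cp.tensor g.cp⟩
  whiskerLeft A _ _ f := ⟨cpTensor (𝟙 _) f.map, (𝟙 A : A ⟶ A).cp.tensor f.cp⟩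
  whiskerRight f B := ⟨cpTensor f.map (𝟙 _), f.cp.tensor (𝟙 B : B ⟶ B).cp⟩
  tensorUnit := ⟨𝟙_ FHilb⟩
  associator A B C := F.mapIso (α_ A.base B.base C.base)
  leftUnitor A := F.mapIso (λ_ A.base)
  rightUnitor A := F.mapIso (ρ_ A.base)

@[simp] theorem tensorHom_map {A B C D : CPM} (f : A ⟶ B) (g : C ⟶ D) :
    (f ⊗ₘ g).map = cpTensor f.map g.map := rfl
@[simp] theorem whiskerLeft_map (A : CPM) {B C : CPM} (f : B ⟶ C) :
    (A ◁ f).map = cpTensor (𝟙 _) f.map := rfl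
@[simp] theorem whiskerRight_map {A B : CPM} (f : A ⟶ B) (C : CPM) :
    (f ▷ C).map = cpTensor f.map (𝟙 _) := rfl

/-- `F` is strict monoidal. -/
theorem F_map_tensorHom {A B C D : FHilb} (f : A ⟶ B) (g : C ⟶ D) :
    F.map f ⊗ₘ F.map g = F.map (f ⊗ₘ g) := hom_ext (cpTensor_double f g)

noncomputable instance : MonoidalCategory CPM :=
  MonoidalCategory.ofTensorHom
    (id_tensorHom_id := fun A B => hom_ext (cpTensor_id A.base B.base))
    (id_tensorHom := fun _ _ _ _ => rfl)
    (tensorHom_id := fun _ _ => rfl)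
    (tensorHom_comp_tensorHom := fun _ _ _ _ => hom_ext (cpTensor_comp _ _ _ _).symm)
    (associator_naturality := fun f g h => hom_ext (cpTensor_assoc f.map g.map h.map))
    (leftUnitor_naturality := fun f => hom_ext (cpTensor_leftUnitor f.map))
    (rightUnitor_naturality := fun f => hom_ext (cpTensor_rightUnitor f.map))
    (pentagon := fun A B C D => by
      have h := congrArg F.map (pentagon A.base B.base C.base D.base)
      rw [← MonoidalCategory.id_tensorHom, ← MonoidalCategory.tensorHom_id] at h
      simp only [Functor.map_comp, ← F_map_tensorHom, F.map_id] at h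
      exact h)
    (triangle := fun A B => by
      have h := congrArg F.map (triangle A.base B.base)
      rw [← MonoidalCategory.id_tensorHom, ← MonoidalCategory.tensorHom_id] at h
      simp only [Functor.map_comp, ← F_map_tensorHom, F.map_id] at h
      exact h)

end CPM

/-! ### Projector-valued spectra and quantum measurements -/

/-- A special commutative `†`-Frobenius algebra on `p`; the comultiplication is `mul†`. -/
structure SpecialCommDaggerFrobenius {C : Type*} [Category C] [MonoidalCategory C]
    [BraidedCategory C] [DaggerCategory C] (p : C) where
  mul : p ⊗ p ⟶ p
  unit : 𝟙_ C ⟶ p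
  one_mul : unit ▷ p ≫ mul = (λ_ p).hom
  mul_one : p ◁ unit ≫ mul = (ρ_ p).hom
  mul_assoc : mul ▷ p ≫ mul = (α_ p p p).hom ≫ p ◁ mul ≫ mul
  mul_comm : (β_ p p).hom ≫ mul = mul
  frobenius_left : p ◁ mul† ≫ (α_ p p p).inv ≫ mul ▷ p = mul ≫ mul†
  frobenius_right : mul† ▷ p ≫ (α_ p p p).hom ≫ p ◁ mul = mul ≫ mul†
  special : mul† ≫ mul = 𝟙 p

/-- A projector-valued spectrum `(Π, μ)` in `FHilb`: a special commutative `†`-Frobenius algebra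
on `p` and a morphism `Π : S ⊗ p ⟶ S` that is `p`-idempotent, `p`-self-adjoint and
`p`-complete. -/
structure ProjectorValuedSpectrum (S p : FHilb) where
  frob : SpecialCommDaggerFrobenius p
  proj : S ⊗ p ⟶ S
  idempotent : proj ▷ p ≫ proj = (α_ S p p).hom ≫ S ◁ frob.mul ≫ proj
  selfAdjoint :
    proj† = (ρ_ S).inv ≫ S ◁ (frob.unit ≫ frob.mul†) ≫ (α_ S p p).inv ≫ proj ▷ p
  complete : (ρ_ S).inv ≫ S ◁ frob.unit ≫ proj = 𝟙 S

namespace CPM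

open FHilb

/-- Discarding a system: the trace `A ⊗ A* ⟶ ℂ`, as a morphism to the unit of `CPM(FHilb)`. -/
noncomputable def discard (A : CPM) : A ⟶ 𝟙_ CPM :=
  ⟨double (λ_ A.base).inv ≫ partialTrace (𝟙_ FHilb) A.base, A.base, (λ_ A.base).inv, rfl⟩

/-- The decoherence morphism of a special commutative `†`-Frobenius algebra: copy with the doubled
comultiplication, then discard one of the copies. -/
noncomputable def decoherence {p : FHilb} (m : SpecialCommDaggerFrobenius p) :
    F.obj p ⟶ F.obj p :=
  (F.map m.mul† : F.obj p ⟶ F.obj p ⊗ F.obj p) ≫ F.obj p ◁ discard (F.obj p) ≫ (ρ_ (F.obj p)).hom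

end CPM

namespace ProjectorValuedSpectrum

open CPM

variable {S p : FHilb} (M : ProjectorValuedSpectrum S p)

/-- The first component `Q(Π)` of the quantum measurement of `(Π, μ)`: the image `F(Π†)` of `Π`
with its property wire decohered. -/
noncomputable def measure : F.obj S ⟶ F.obj S ⊗ F.obj p :=
  (F.map M.proj† : F.obj S ⟶ F.obj S ⊗ F.obj p) ≫ F.obj S ◁ decoherence M.frob

/-- The second component `Q(μ)` of the quantum measurement of `(Π, μ)`: the image `F(μ†)` of `μ`
with all its property wires decohered. -/
noncomputable def measureCopy : F.obj p ⟶ F.obj p ⊗ F.obj p :=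
  decoherence M.frob ≫ (F.map M.frob.mul† : F.obj p ⟶ F.obj p ⊗ F.obj p) ≫
    (decoherence M.frob ⊗ₘ decoherence M.frob)

end ProjectorValuedSpectrum

/-!
The Frobenius law makes `(Π, Π†, μ, μ†)` a weak update structure, and `F` preserves it. Decoherence
`D` is the marginal of the coassociative comultiplication `F(μ†)` along the discarding effect, hence
slides through `F(μ†)`; it is idempotent because doubled isometries preserve discarding, and it is
self-adjoint because `⟪D(|a⟩⟨a'|), |b⟩⟨b'|⟫ = ⟪a · b', b · a'⟫`, with `·` the product `μ`.
A self-adjoint idempotent sliding through copying can be absorbed into all four update axioms.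
-/

open FHilb CPM

/-- A dagger monoidal category: the tensor product commutes with the dagger and the coherence
isomorphisms are unitary. -/
class DaggerMonoidalCategory (C : Type*) [Category C] [MonoidalCategory C] [DaggerCategory C] :
    Prop where
  dagger_tensorHom : ∀ {X Y X' Y' : C} (f : X ⟶ Y) (g : X' ⟶ Y'), (f ⊗ₘ g)† = f† ⊗ₘ g†
  dagger_associator_hom : ∀ X Y Z : C, (α_ X Y Z).hom† = (α_ X Y Z).inv
  dagger_leftUnitor_hom : ∀ X : C, (λ_ X).hom† = (λ_ X).inv
  dagger_rightUnitor_hom : ∀ X : C, (ρ_ X).hom† = (ρ_ X).inv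

namespace DaggerMonoidalCategory

variable {C : Type*} [Category C] [MonoidalCategory C] [DaggerCategory C]
  [DaggerMonoidalCategory C] {X Y : C}

theorem dagger_whiskerLeft (Z : C) (f : X ⟶ Y) : (Z ◁ f)† = Z ◁ f† := by
  rw [← id_tensorHom, dagger_tensorHom, DaggerCategory.dagger_id, id_tensorHom]

theorem dagger_whiskerRight (f : X ⟶ Y) (Z : C) : (f ▷ Z)† = f† ▷ Z := by
  rw [← tensorHom_id, dagger_tensorHom, DaggerCategory.dagger_id, tensorHom_id]

end DaggerMonoidalCategory

open DaggerCategory DaggerMonoidalCategory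

section Monoidal

variable {C : Type*} [Category C] [MonoidalCategory C] {S p : C}

theorem IsWeakUpdateStructure.comp_idempotent {put : S ⊗ p ⟶ S} {get : S ⟶ S ⊗ p}
    {mix : p ⊗ p ⟶ p} {copy : p ⟶ p ⊗ p} (h : IsWeakUpdateStructure put get mix copy)
    {d : p ⟶ p} (idem : d ≫ d = d)
    (mix_left : d ▷ p ≫ mix = mix ≫ d) (mix_right : p ◁ d ≫ mix = mix ≫ d)
    (copy_left : copy ≫ d ▷ p = d ≫ copy) (copy_right : copy ≫ p ◁ d = d ≫ copy) :
    IsWeakUpdateStructure (S ◁ d ≫ put) (get ≫ S ◁ d) (mix ≫ d) (d ≫ copy) where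
  put_put := by
    calc (S ◁ d ≫ put) ▷ p ≫ S ◁ d ≫ put
        = (S ◁ d) ▷ p ≫ (S ⊗ p) ◁ d ≫ put ▷ p ≫ put := by
          rw [comp_whiskerRight, Category.assoc, whisker_exchange_assoc]
      _ = (α_ S p p).hom ≫ S ◁ (d ▷ p ≫ p ◁ d ≫ mix) ≫ put := by
          rw [h.put_put]; monoidal
      _ = (α_ S p p).hom ≫ S ◁ (mix ≫ d) ≫ S ◁ d ≫ put := by
          rw [mix_right, reassoc_of% mix_left, ← whiskerLeft_comp_assoc, Category.assoc]
  get_get := by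
    calc (get ≫ S ◁ d) ≫ (get ≫ S ◁ d) ▷ p
        = get ≫ get ▷ p ≫ (S ⊗ p) ◁ d ≫ (S ◁ d) ▷ p := by
          rw [comp_whiskerRight, Category.assoc, whisker_exchange_assoc]
      _ = get ≫ S ◁ (copy ≫ p ◁ d ≫ d ▷ p) ≫ (α_ S p p).inv := by
          rw [reassoc_of% h.get_get]; monoidal
      _ = (get ≫ S ◁ d) ≫ S ◁ (d ≫ copy) ≫ (α_ S p p).inv := by
          rw [reassoc_of% copy_right, copy_left, whiskerLeft_comp, Category.assoc, Category.assoc]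
  put_get := by
    calc (S ◁ d ≫ put) ≫ get ≫ S ◁ d
        = S ◁ d ≫ S ◁ copy ≫ (α_ S p p).inv ≫ put ▷ p ≫ S ◁ d := by
          rw [Category.assoc, reassoc_of% h.put_get]
      _ = S ◁ (d ≫ copy ≫ p ◁ d) ≫ (α_ S p p).inv ≫ put ▷ p := by
          rw [← whisker_exchange]; monoidal
      _ = S ◁ (d ≫ copy ≫ d ▷ p) ≫ (α_ S p p).inv ≫ put ▷ p := by
          rw [copy_right, copy_left]
      _ = S ◁ (d ≫ copy) ≫ (α_ S p p).inv ≫ (S ◁ d ≫ put) ▷ p := by monoidal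
  repeat_update := by
    calc S ◁ (d ≫ copy) ≫ (α_ S p p).inv ≫ (S ◁ d ≫ put) ▷ p ≫ S ◁ d ≫ put
        = S ◁ (d ≫ copy ≫ d ▷ p ≫ p ◁ d) ≫ (α_ S p p).inv ≫ put ▷ p ≫ put := by
          rw [comp_whiskerRight, Category.assoc, ← whisker_exchange_assoc]; monoidal
      _ = S ◁ d ≫ S ◁ copy ≫ (α_ S p p).inv ≫ put ▷ p ≫ put := by
          rw [reassoc_of% copy_left, copy_right, reassoc_of% idem, reassoc_of% idem,
            whiskerLeft_comp_assoc]
      _ = S ◁ d ≫ put := by rw [h.repeat_update]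

/-- The marginal of a comultiplication `δ` along an effect `ε`: the second output of `δ` is
annihilated by `ε`. -/
def marginal (δ : p ⟶ p ⊗ p) (ε : p ⟶ 𝟙_ C) : p ⟶ p := δ ≫ p ◁ ε ≫ (ρ_ p).hom

section Coassociative

variable {δ : p ⟶ p ⊗ p} {ε : p ⟶ 𝟙_ C}
  (coassoc : δ ≫ δ ▷ p = δ ≫ p ◁ δ ≫ (α_ p p p).inv)

include coassoc

theorem coassoc_comp_whiskerLeft_marginal : δ ≫ p ◁ marginal δ ε = marginal δ ε ≫ δ := by
  calc δ ≫ p ◁ (δ ≫ p ◁ ε ≫ (ρ_ p).hom)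
      = (δ ≫ p ◁ δ ≫ (α_ p p p).inv) ≫ (p ⊗ p) ◁ ε ≫ (ρ_ (p ⊗ p)).hom := by monoidal
    _ = δ ≫ p ◁ ε ≫ δ ▷ 𝟙_ C ≫ (ρ_ (p ⊗ p)).hom := by
        rw [← coassoc, Category.assoc, whisker_exchange_assoc]
    _ = (δ ≫ p ◁ ε ≫ (ρ_ p).hom) ≫ δ := by
        rw [rightUnitor_naturality, Category.assoc, Category.assoc]

theorem marginal_idempotent (normalized : marginal δ ε ≫ ε = ε) :
    marginal δ ε ≫ marginal δ ε = marginal δ ε := by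
  calc marginal δ ε ≫ δ ≫ p ◁ ε ≫ (ρ_ p).hom
      = δ ≫ p ◁ (marginal δ ε ≫ ε) ≫ (ρ_ p).hom := by
        rw [← reassoc_of% coassoc_comp_whiskerLeft_marginal coassoc, whiskerLeft_comp_assoc]
    _ = marginal δ ε := by rw [normalized, marginal]

end Coassociative

theorem comp_whiskerRight_of_comp_whiskerLeft {δ : p ⟶ p ⊗ p} {d : p ⟶ p}
    {swap : p ⊗ p ⟶ p ⊗ p} (comm : δ ≫ swap = δ)
    (naturality : p ◁ d ≫ swap = swap ≫ d ▷ p) (slide : δ ≫ p ◁ d = d ≫ δ) :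
    δ ≫ d ▷ p = d ≫ δ := by
  calc δ ≫ d ▷ p
      = δ ≫ p ◁ d ≫ swap := by rw [naturality, reassoc_of% comm]
    _ = d ≫ δ := by rw [reassoc_of% slide, comm]

theorem IsWeakUpdateStructure.decohere [DaggerCategory C] [DaggerMonoidalCategory C]
    {put : S ⊗ p ⟶ S} {get : S ⟶ S ⊗ p} {mix : p ⊗ p ⟶ p} {copy : p ⟶ p ⊗ p}
    (h : IsWeakUpdateStructure put get mix copy) (dagger_get : get† = put)
    (dagger_copy : copy† = mix) {d : p ⟶ p} (selfAdjoint : d† = d) (idem : d ≫ d = d)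
    (copy_left : copy ≫ d ▷ p = d ≫ copy) (copy_right : copy ≫ p ◁ d = d ≫ copy) :
    IsWeakUpdateStructure (get ≫ S ◁ d)† (get ≫ S ◁ d)
      (d ≫ copy ≫ (d ⊗ₘ d))† (d ≫ copy ≫ (d ⊗ₘ d)) := by
  have copy_eq : d ≫ copy ≫ (d ⊗ₘ d) = d ≫ copy := by
    rw [MonoidalCategory.tensorHom_def, reassoc_of% copy_left, copy_right, reassoc_of% idem,
      reassoc_of% idem]
  have mix_left : d ▷ p ≫ mix = mix ≫ d := by
    simpa only [dagger_comp, dagger_whiskerRight, dagger_copy, selfAdjoint] using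
      congrArg dagger copy_left
  have mix_right : p ◁ d ≫ mix = mix ≫ d := by
    simpa only [dagger_comp, dagger_whiskerLeft, dagger_copy, selfAdjoint] using
      congrArg dagger copy_right
  rw [copy_eq, dagger_comp, dagger_comp, dagger_whiskerLeft, selfAdjoint, dagger_get,
    dagger_copy]
  exact h.comp_idempotent idem mix_left mix_right copy_left copy_right

end Monoidal

namespace SpecialCommDaggerFrobenius

variable {C : Type*} [Category C] [MonoidalCategory C] [BraidedCategory C] [DaggerCategory C]
  {S p : C} (m : SpecialCommDaggerFrobenius p)

theorem rightUnitor_inv_comp_cup_comp_mul :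
    (ρ_ p).inv ≫ p ◁ (m.unit ≫ m.mul†) ≫ (α_ p p p).inv ≫ m.mul ▷ p = m.mul† := by
  rw [whiskerLeft_comp_assoc, m.frobenius_left, reassoc_of% m.mul_one, Iso.inv_hom_id_assoc]

section Projector

variable {m} {proj : S ⊗ p ⟶ S}
  (idempotent : proj ▷ p ≫ proj = (α_ S p p).hom ≫ S ◁ m.mul ≫ proj)
  (selfAdjoint : proj† = (ρ_ S).inv ≫ S ◁ (m.unit ≫ m.mul†) ≫ (α_ S p p).inv ≫ proj ▷ p)

include idempotent selfAdjoint

theorem proj_comp_dagger : proj ≫ proj† = S ◁ m.mul† ≫ (α_ S p p).inv ≫ proj ▷ p := by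
  calc proj ≫ proj†
      = (ρ_ (S ⊗ p)).inv ≫ proj ▷ 𝟙_ C ≫ S ◁ (m.unit ≫ m.mul†) ≫ (α_ S p p).inv ≫ proj ▷ p := by
        rw [selfAdjoint, rightUnitor_inv_naturality_assoc]
    _ = (ρ_ (S ⊗ p)).inv ≫ (S ⊗ p) ◁ (m.unit ≫ m.mul†) ≫ (α_ (S ⊗ p) p p).inv ≫
          (proj ▷ p ≫ proj) ▷ p := by
        rw [← whisker_exchange_assoc]; monoidal
    _ = S ◁ ((ρ_ p).inv ≫ p ◁ (m.unit ≫ m.mul†) ≫ (α_ p p p).inv ≫ m.mul ▷ p) ≫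
          (α_ S p p).inv ≫ proj ▷ p := by
        rw [idempotent]; monoidal
    _ = S ◁ m.mul† ≫ (α_ S p p).inv ≫ proj ▷ p := by rw [m.rightUnitor_inv_comp_cup_comp_mul]

theorem isWeakUpdateStructure [DaggerMonoidalCategory C] :
    IsWeakUpdateStructure proj proj† m.mul m.mul† where
  put_put := idempotent
  get_get := by
    have h := congrArg dagger idempotent
    rwa [dagger_comp, dagger_comp, dagger_comp, dagger_whiskerLeft, dagger_whiskerRight,
      dagger_associator_hom, Category.assoc] at h
  put_get := proj_comp_dagger idempotent selfAdjoint
  repeat_update := by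
    rw [idempotent, Iso.inv_hom_id_assoc, ← whiskerLeft_comp_assoc, m.special, whiskerLeft_id,
      Category.id_comp]

end Projector

theorem mul_isWeakUpdateStructure [DaggerMonoidalCategory C]
    (m : SpecialCommDaggerFrobenius p) : IsWeakUpdateStructure m.mul m.mul† m.mul m.mul† :=
  isWeakUpdateStructure m.mul_assoc m.rightUnitor_inv_comp_cup_comp_mul.symm

end SpecialCommDaggerFrobenius

namespace FHilb

variable {A B C D : FHilb}

instance : DaggerMonoidalCategory FHilb where
  dagger_tensorHom f g := by
    refine (eq_dagger (span_tmul Submodule.span_univ Submodule.span_univ)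
      (span_tmul Submodule.span_univ Submodule.span_univ) ?_).symm
    rintro _ ⟨y, -, y', -, rfl⟩ _ ⟨x, -, x', -, rfl⟩
    simp [LinearMap.adjoint_inner_left]
  dagger_associator_hom X Y Z := by
    refine (eq_dagger (span_tmul Submodule.span_univ
      (span_tmul Submodule.span_univ Submodule.span_univ))
      (span_tmul (span_tmul Submodule.span_univ Submodule.span_univ) Submodule.span_univ) ?_).symm
    rintro _ ⟨x, -, _, ⟨y, -, z, -, rfl⟩, rfl⟩ _ ⟨_, ⟨x', -, y', -, rfl⟩, z', -, rfl⟩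
    simp [mul_assoc]
  dagger_leftUnitor_hom X := by
    refine (eq_dagger Submodule.span_univ
      (span_tmul Submodule.span_univ Submodule.span_univ) ?_).symm
    rintro x - _ ⟨(z : ℂ), -, x', -, rfl⟩
    simp
  dagger_rightUnitor_hom X := by
    refine (eq_dagger Submodule.span_univ
      (span_tmul Submodule.span_univ Submodule.span_univ) ?_).symm
    rintro x - _ ⟨x', -, (z : ℂ), -, rfl⟩
    simp [mul_comm]

theorem dagger_shuffle_hom (A B : FHilb) : (shuffle A B).hom† = (shuffle A B).inv := by
  refine (eq_dagger (span_dbl (span_tmul Submodule.span_univ Submodule.span_univ))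
    (span_tmul (span_dbl Submodule.span_univ) (span_dbl Submodule.span_univ)) ?_).symm
  rintro _ ⟨_, ⟨a, -, b, -, rfl⟩, _, ⟨a', -, b', -, rfl⟩, rfl⟩
    _ ⟨_, ⟨c, -, c', -, rfl⟩, _, ⟨d, -, d', -, rfl⟩, rfl⟩
  simp [mul_mul_mul_comm]

theorem dagger_cpTensor (f : dbl A ⟶ dbl B) (g : dbl C ⟶ dbl D) :
    (cpTensor f g)† = cpTensor f† g† := by
  have hinv : (shuffle A C).inv† = (shuffle A C).hom := by
    rw [← dagger_shuffle_hom, dagger_dagger]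
  simp only [cpTensor, dagger_comp, dagger_tensorHom, dagger_shuffle_hom, hinv, Category.assoc]

theorem dagger_braiding_hom (A B : FHilb) : (β_ A B).hom† = (β_ B A).hom := by
  refine (eq_dagger (span_tmul Submodule.span_univ Submodule.span_univ)
    (span_tmul Submodule.span_univ Submodule.span_univ) ?_).symm
  rintro _ ⟨b, -, a, -, rfl⟩ _ ⟨a', -, b', -, rfl⟩
  simp [mul_comm]

theorem cpTensor_double_braiding (f : dbl A ⟶ dbl B) (g : dbl C ⟶ dbl D) :
    cpTensor f g ≫ double (β_ B D).hom = double (β_ A C).hom ≫ cpTensor g f := by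
  have shuffle_braiding (X Y : FHilb) : (shuffle X Y).hom ≫ double (β_ X Y).hom =
      (β_ (dbl X) (dbl Y)).hom ≫ (shuffle Y X).hom := shuffle_ext fun _ _ _ _ => by simp
  rw [← cancel_epi (shuffle A C).hom, reassoc_of% shuffle_braiding]
  simp only [cpTensor, Category.assoc, Iso.hom_inv_id_assoc, shuffle_braiding,
    BraidedCategory.braiding_naturality_assoc]

theorem cpTensor_id_trace (A B : FHilb) :
    cpTensor (𝟙 (dbl A)) (double (λ_ B).inv ≫ partialTrace (𝟙_ FHilb) B) ≫ double (ρ_ A).hom =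
      partialTrace A B := by
  refine span_ext (span_dbl (span_tmul Submodule.span_univ Submodule.span_univ)) ?_
  rintro _ ⟨_, ⟨a, -, b, -, rfl⟩, _, ⟨a', -, b', -, rfl⟩, rfl⟩
  simp [cpTensor]

/-- The ket `|a⟩` on the left factor: the map `b ↦ a ⊗ b`, whose dagger contracts the left factor
of a tensor product against `a`. -/
noncomputable def ketLeft (a : A) (B : FHilb) : B ⟶ A ⊗ B := ⟨TensorProduct.mk ℂ A B a⟩

@[simp] theorem ketLeft_lin (a : A) (b : B) : (ketLeft a B).lin b = a ⊗ᵥ b := rfl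

@[simp] theorem dagger_ketLeft_tmul (a a' : A) (b : B) :
    (ketLeft a B)†.lin (a' ⊗ᵥ b) = (inner ℂ a a' : ℂ) • b := by
  refine ext_inner_left ℂ fun c => ?_
  rw [dagger_lin, LinearMap.adjoint_inner_right, ketLeft_lin, inner_tmul, inner_smul_right]

theorem associator_hom_comp_whiskerLeft_comp_dagger_ketLeft (a : A) (f : B ⊗ C ⟶ D) :
    (α_ A B C).hom ≫ A ◁ f ≫ (ketLeft a D)† = (ketLeft a B)† ▷ C ≫ f :=
  tensor_ext₃ fun a' b c => by
    simp only [comp_lin, LinearMap.comp_apply, associator_hom_tmul, whiskerLeft_tmul,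
      whiskerRight_tmul, dagger_ketLeft_tmul, smul_tmul, map_smul]

theorem inner_partialTrace_bra (x y : (A ⊗ B : FHilb)) (a a' : A) :
    inner ℂ ((partialTrace A B).lin (x ⊗ᵥ bra y)) (a ⊗ᵥ bra a') =
      inner ℂ ((ketLeft a B)†.lin x) ((ketLeft a' B)†.lin y) := by
  induction x using tensor_induction with
  | zero => simp only [zero_tmul, map_zero, inner_zero_left]
  | add x x' hx hx' => simp only [FHilb.add_tmul, map_add, inner_add_left, hx, hx']
  | tmul b c =>
    induction y using tensor_induction with
    | zero => simp only [bra_zero, tmul_zero, map_zero, inner_zero_left, inner_zero_right]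
    | add y y' hy hy' =>
      simp only [bra_add, FHilb.tmul_add, map_add, inner_add_left, inner_add_right, hy, hy']
    | tmul b' c' =>
      simp only [partialTrace_bra, dagger_ketLeft_tmul, inner_smul_left, inner_smul_right,
        inner_tmul, inner_bra, inner_conj_symm]
      ring

end FHilb

namespace CPM

instance : DaggerMonoidalCategory CPM where
  dagger_tensorHom f g := hom_ext (dagger_cpTensor f.map g.map)
  dagger_associator_hom A B C := hom_ext <|
    (dagger_double _).trans (congrArg double (dagger_associator_hom A.base B.base C.base))
  dagger_leftUnitor_hom A := hom_ext <|
    (dagger_double _).trans (congrArg double (dagger_leftUnitor_hom A.base))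
  dagger_rightUnitor_hom A := hom_ext <|
    (dagger_double _).trans (congrArg double (dagger_rightUnitor_hom A.base))

theorem dagger_F_map_dagger {A B : FHilb} (f : A ⟶ B) : (F.map f†)† = F.map f :=
  hom_ext ((dagger_double f†).trans (congrArg double (dagger_dagger f)))

theorem F_map_whiskerLeft (A : FHilb) {B C : FHilb} (f : B ⟶ C) :
    F.map (A ◁ f) = F.obj A ◁ F.map f := by
  rw [← id_tensorHom, ← F_map_tensorHom, F.map_id]; exact id_tensorHom _ _

theorem F_map_whiskerRight {A B : FHilb} (f : A ⟶ B) (C : FHilb) :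
    F.map (f ▷ C) = F.map f ▷ F.obj C := by
  rw [← tensorHom_id, ← F_map_tensorHom, F.map_id]; exact tensorHom_id _ _

/- In the fields below, `exact` identifies `F.obj A ⊗ F.obj B` with `F.obj (A ⊗ B)` and the
associator of `CPM` with the image of that of `FHilb`, which agree definitionally. -/
theorem _root_.IsWeakUpdateStructure.F_map {S p : FHilb} {put : S ⊗ p ⟶ S} {get : S ⟶ S ⊗ p}
    {mix : p ⊗ p ⟶ p} {copy : p ⟶ p ⊗ p} (h : IsWeakUpdateStructure put get mix copy) :
    IsWeakUpdateStructure (S := F.obj S) (p := F.obj p)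
      (F.map put) (F.map get) (F.map mix) (F.map copy) where
  put_put := by
    have h := congrArg F.map h.put_put
    simp only [F.map_comp, F_map_whiskerLeft, F_map_whiskerRight] at h
    exact h
  get_get := by
    have h := congrArg F.map h.get_get
    simp only [F.map_comp, F_map_whiskerLeft, F_map_whiskerRight] at h
    exact h
  put_get := by
    have h := congrArg F.map h.put_get
    simp only [F.map_comp, F_map_whiskerLeft, F_map_whiskerRight] at h
    exact h
  repeat_update := by
    have h := congrArg F.map h.repeat_update
    simp only [F.map_comp, F_map_whiskerLeft, F_map_whiskerRight] at h
    exact h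

theorem whiskerLeft_discard_comp_rightUnitor_map (A B : CPM) :
    (A ◁ discard B ≫ (ρ_ A).hom).map = partialTrace A.base B.base :=
  cpTensor_id_trace A.base B.base

theorem discard_map_lin (A : CPM) (a a' : A.base) :
    (discard A).map.lin (a ⊗ᵥ bra a') =
      (inner ℂ a' a : ℂ) • (tmul (A := 𝟙_ FHilb) (1 : ℂ) (bra (A := 𝟙_ FHilb) (1 : ℂ))) := by
  simp only [discard, comp_lin, LinearMap.comp_apply, double_tmul, FHilb.leftUnitor_inv_apply,
    partialTrace_bra]

theorem discard_tensor (A B : CPM) :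
    A ◁ discard B ≫ (ρ_ A).hom ≫ discard A = discard (A ⊗ B) := by
  rw [← Category.assoc]
  refine hom_ext ?_
  rw [comp_map, whiskerLeft_discard_comp_rightUnitor_map]
  refine span_ext (span_dbl (span_tmul Submodule.span_univ Submodule.span_univ)) ?_
  rintro _ ⟨_, ⟨a, -, b, -, rfl⟩, _, ⟨a', -, b', -, rfl⟩, rfl⟩
  refine Eq.trans ?_ (discard_map_lin (A ⊗ B) _ _).symm
  rw [inner_tmul, mul_comm, comp_lin, LinearMap.comp_apply, partialTrace_bra, map_smul,
    discard_map_lin, smul_smul]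

theorem F_map_comp_discard {A B : FHilb} {f : A ⟶ B} (isometry : f ≫ f† = 𝟙 A) :
    F.map f ≫ discard (F.obj B) = discard (F.obj A) := by
  refine hom_ext (dbl_ext fun (a a' : A) => ?_)
  have inner_map : inner ℂ (f.lin a') (f.lin a) = inner ℂ a' a := by
    rw [← LinearMap.adjoint_inner_right, ← dagger_lin, ← LinearMap.comp_apply, ← comp_lin,
      isometry, id_lin, LinearMap.id_apply]
  calc (discard (F.obj B)).map.lin ((double f).lin (a ⊗ᵥ bra a'))
      = (discard (F.obj B)).map.lin (f.lin a ⊗ᵥ bra (f.lin a')) :=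
        congrArg (discard (F.obj B)).map.lin (double_tmul f a a')
    _ = (inner ℂ (f.lin a') (f.lin a) : ℂ) • _ := discard_map_lin (F.obj B) _ _
    _ = (discard (F.obj A)).map.lin (a ⊗ᵥ bra a') := by
        rw [inner_map]; exact (discard_map_lin (F.obj A) a a').symm

end CPM

section Decoherence

variable {p : FHilb} (m : SpecialCommDaggerFrobenius p)

namespace SpecialCommDaggerFrobenius

/-- Multiplication by `b`. -/
noncomputable def mulLeft (b : p) : p ⟶ p := ketLeft b p ≫ m.mul

theorem mulLeft_lin (b x : p) : (m.mulLeft b).lin x = m.mul.lin (b ⊗ᵥ x) := rfl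

theorem mul_lin_comm (a b : p) : m.mul.lin (a ⊗ᵥ b) = m.mul.lin (b ⊗ᵥ a) :=
  congrArg (fun f => f.lin (b ⊗ᵥ a)) m.mul_comm

theorem dagger_mulLeft_mul (a b c : p) :
    (m.mulLeft a)†.lin (m.mul.lin (b ⊗ᵥ c)) = m.mul.lin ((m.mulLeft a)†.lin b ⊗ᵥ c) := by
  have module_map : m.mul ≫ (m.mulLeft a)† = (m.mulLeft a)† ▷ p ≫ m.mul := by
    rw [mulLeft, dagger_comp, ← reassoc_of% m.frobenius_right,
      associator_hom_comp_whiskerLeft_comp_dagger_ketLeft, comp_whiskerRight, Category.assoc]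
  exact congrArg (fun f => f.lin (b ⊗ᵥ c)) module_map

theorem inner_dagger_mulLeft (a a' b b' : p) :
    inner ℂ ((m.mulLeft b)†.lin a) ((m.mulLeft b')†.lin a') =
      inner ℂ (m.mul.lin (a ⊗ᵥ b')) (m.mul.lin (b ⊗ᵥ a')) := by
  rw [dagger_lin (m.mulLeft b'), LinearMap.adjoint_inner_right, mulLeft_lin, mul_lin_comm,
    ← dagger_mulLeft_mul, dagger_lin, LinearMap.adjoint_inner_left, mulLeft_lin]

end SpecialCommDaggerFrobenius

namespace CPM

theorem decoherence_map : (decoherence m).map = double m.mul† ≫ partialTrace p p :=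
  congrArg (double m.mul† ≫ ·) (whiskerLeft_discard_comp_rightUnitor_map (F.obj p) (F.obj p))

theorem inner_double_dagger_mul_comp_partialTrace (a a' b b' : p) :
    inner ℂ ((double m.mul† ≫ partialTrace p p).lin (a ⊗ᵥ bra a')) (b ⊗ᵥ bra b') =
      inner ℂ (m.mul.lin (a ⊗ᵥ b')) (m.mul.lin (b ⊗ᵥ a')) := by
  rw [comp_lin, LinearMap.comp_apply, double_tmul, inner_partialTrace_bra,
    ← m.inner_dagger_mulLeft, SpecialCommDaggerFrobenius.mulLeft,
    SpecialCommDaggerFrobenius.mulLeft, dagger_comp, dagger_comp, comp_lin, comp_lin,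
    LinearMap.comp_apply, LinearMap.comp_apply]

theorem dagger_decoherence : (decoherence m)† = decoherence m := by
  refine hom_ext ?_
  rw [dagger_map, decoherence_map]
  refine (eq_dagger (span_dbl Submodule.span_univ) (span_dbl Submodule.span_univ) ?_).symm
  rintro _ ⟨a, -, a', -, rfl⟩ _ ⟨b, -, b', -, rfl⟩
  rw [inner_double_dagger_mul_comp_partialTrace, ← inner_conj_symm,
    ← inner_double_dagger_mul_comp_partialTrace, inner_conj_symm]

theorem F_map_comul_coassoc :
    (F.map m.mul† : F.obj p ⟶ F.obj p ⊗ F.obj p) ≫ F.map m.mul† ▷ F.obj p =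
      F.map m.mul† ≫ F.obj p ◁ F.map m.mul† ≫ (α_ (F.obj p) (F.obj p) (F.obj p)).inv :=
  m.mul_isWeakUpdateStructure.F_map.get_get

theorem F_map_comul_comp_whiskerLeft_decoherence :
    (F.map m.mul† : F.obj p ⟶ F.obj p ⊗ F.obj p) ≫ F.obj p ◁ decoherence m =
      decoherence m ≫ F.map m.mul† :=
  coassoc_comp_whiskerLeft_marginal (F_map_comul_coassoc m)

theorem F_map_comul_comp_whiskerRight_decoherence :
    (F.map m.mul† : F.obj p ⟶ F.obj p ⊗ F.obj p) ≫ decoherence m ▷ F.obj p =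
      decoherence m ≫ F.map m.mul† := by
  have comm : m.mul† ≫ (β_ p p).hom = m.mul† := by
    rw [← dagger_braiding_hom, ← dagger_comp, m.mul_comm]
  have F_map_comm : F.map m.mul† ≫ F.map (β_ p p).hom = F.map m.mul† := by
    rw [← F.map_comp, comm]
  exact comp_whiskerRight_of_comp_whiskerLeft F_map_comm
    (hom_ext (cpTensor_double_braiding _ _)) (F_map_comul_comp_whiskerLeft_decoherence m)

theorem decoherence_comp_discard : decoherence m ≫ discard (F.obj p) = discard (F.obj p) := by
  have isometry : m.mul† ≫ m.mul†† = 𝟙 p := by rw [dagger_dagger, m.special]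
  calc decoherence m ≫ discard (F.obj p)
      = F.map m.mul† ≫ discard (F.obj p ⊗ F.obj p) := by
        rw [← discard_tensor, ← Category.assoc (_ ◁ _)]; exact Category.assoc _ _ _
    _ = discard (F.obj p) := F_map_comp_discard isometry

theorem decoherence_idempotent : decoherence m ≫ decoherence m = decoherence m :=
  marginal_idempotent (F_map_comul_coassoc m) (decoherence_comp_discard m)

end CPM

end Decoherence

theorem mainTheorem6_general {S p : FHilb} (m : SpecialCommDaggerFrobenius p) {proj : S ⊗ p ⟶ S}
    (idempotent : proj ▷ p ≫ proj = (α_ S p p).hom ≫ S ◁ m.mul ≫ proj)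
    (selfAdjoint : proj† = (ρ_ S).inv ≫ S ◁ (m.unit ≫ m.mul†) ≫ (α_ S p p).inv ≫ proj ▷ p)
    {get : F.obj S ⟶ F.obj S ⊗ F.obj p} {copy : F.obj p ⟶ F.obj p ⊗ F.obj p}
    (get_eq : get = F.map proj† ≫ F.obj S ◁ decoherence m)
    (copy_eq : copy = decoherence m ≫ F.map m.mul† ≫ (decoherence m ⊗ₘ decoherence m)) :
    IsWeakUpdateStructure get† get copy† copy := by
  have doubled := (SpecialCommDaggerFrobenius.isWeakUpdateStructure idempotent selfAdjoint).F_map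
  subst get_eq copy_eq
  exact doubled.decohere (dagger_F_map_dagger proj) (dagger_F_map_dagger m.mul)
    (dagger_decoherence m) (decoherence_idempotent m)
    (F_map_comul_comp_whiskerRight_decoherence m) (F_map_comul_comp_whiskerLeft_decoherence m)

theorem mainTheorem6 {S p : FHilb} (M : ProjectorValuedSpectrum S p) :
    IsWeakUpdateStructure M.measure† M.measure M.measureCopy† M.measureCopy :=
  mainTheorem6_general M.frob M.idempotent M.selfAdjoint rfl rfl
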